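/- **Setting.** Let $R$ be a commutative ring with $m$ commuting derivations $\partial_1,\dots,\partial_m$; put $\partial^\sigma=\partial_1^{\sigma_1}\cdots\partial_m^{\sigma_m}$, $|\sigma|=\sigma_1+\dots+\sigma_m$ for $\sigma\in\mathbf Z_+^m$. A differential extension $\tilde R\supset R$ is a commutative ring containing $R$ with $m$ commuting derivations extending those of $R$. In any differential ring write $a\sim b$ if $a-b\in\sum_{\ell}\operatorname{Im}\partial_\ell$, and $\langle w,y\rangle=\sum_i w_iy_i$. Let $\mathcal G=R^N$ be a differential Lie algebra: its bracket is given by bilinear differential operators with coefficients in $R$, and is skewsymmetric and satisfies the Jacobi identity on $\tilde R^N$ for every differential extension $\tilde R\supset R$. For $X\in\mathcal G$ the coadjoint operator $v\mapsto X^{\cdot}v$ is minus the formal adjoint of $Y\mapsto[X,Y]$, so $\langle X^{\cdot}v,Y\rangle\sim-\langle v,[X,Y]\rangle$. Let $\mathcal G^*=R^N$ also carry a differential Lie algebra structure (with bracket also denoted $[\ ,\ ]$ and dual action $u^{\cdot}Y$ on $\mathcal G$) such that $\mathcal G\oplus\mathcal G^*$ with $$[(X,u),(Y,v)]=([X,Y]+u^{\cdot}Y-v^{\cdot}X,\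 [u,v]+X^{\cdot}v-Y^{\cdot}u)$$ is a differential Lie algebra. All these operators act over every differential extension. Let $C_{\mathcal G^*}=R[u_i^{(\sigma)}]$, $1\le i\le N$, $\sigma\in\mathbf Z_+^m$, with $\partial_\ell u_i^{(\sigma)}=u_i^{(\sigma+e_\ell)}$, $u_i=u_i^{(0)}$, $\mathbf u=(u_1,\dots,u_N)$, and define $\tilde R[u_i^{(\sigma)}]$ in the same way. Put $\frac{\delta H}{\delta u_i}=\sum_\sigma(-1)^{|\sigma|}\partial^\sigma\frac{\partial H}{\partial u_i^{(\sigma)}}$. Let $B$ be an arbitrary Hamiltonian matrix over $C_{\mathcal G^*}$: an $N\times N$ matrix of differential operators with coefficients in $C_{\mathcal G^*}$ such that $B^\dagger=-B$ and the bracket $$\{H,F\}=\Big(\frac{\delta F}{\delta\mathbf u}\Big)^{t}B\Big(\frac{\delta H}{\delta\mathbf u}\Big)$$ satisfies the Jacobi identity modulo $\sim$ on $C_{\mathcal G^*}$. The same formula defines $\{\ ,\ \}$ on $\tilde R[u_i^{(\sigma)}]$. For $X\in\tilde R^N$ let $X^\wedge$ be the $\tilde R$-linear derivation of $\tilde R[u_i^{(\sigma)}]$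 that commutes with all $\partial_\ell$ and satisfies $X^\wedge(\mathbf u)=X^{\cdot}\mathbf u$. For $H\in\tilde R[u_i^{(\sigma)}]$ let $H^\sim\in\tilde R[u_i^{(\sigma)}]^N$ be defined by the relation $\langle H^\sim,X\rangle\sim X^\wedge(H)$ in $\hat R[u_i^{(\sigma)}]$, for all differential extensions $\hat R\supset\tilde R$ and all $X\in\hat R^N$. For $X\in\mathcal G$ and $H,F\in\tilde R[u_i^{(\sigma)}]$ consider the infinitesimal Hamiltonian action criterion $$X^\wedge(\{H,F\})-\{X^\wedge(H),F\}-\{H,X^\wedge(F)\}\ \sim\ \langle[H^\sim,F^\sim],X\rangle .\tag{$*$}$$ **Theorem 5.39.** It is enough to verify the criterion $(*)$ for Hamiltonians that are linear in $\mathbf u$. Precisely, for every $X\in\mathcal G$ the following are equivalent: 1. $(*)$ holds for all differential extensions $\tilde R\supset R$ (including $\tilde R=R$) and all $H,F\in\tilde R[u_i^{(\sigma)}]$; 2. $(*)$ holds for all differential extensions $\tilde R\supset R$ and all linear $H=\langle\mathbf u,\mathbf Y\rangle$, $F=\langle\mathbf u,\mathbf Z\rangle$ with $\mathbf Y,\mathbf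 Z\in\tilde R^N$. -/

import Mathlib

universe u

namespace DiffHam

open MvPolynomial

/-- A commutative ring with `m` commuting derivations. -/
class DiffRing (m : ℕ) (A : Type*) [CommRing A] where
  /-- the derivations -/
  d : Fin m → Derivation ℤ A A
  /-- they commute -/
  d_comm : ∀ (i j : Fin m) (a : A), d i (d j a) = d j (d i a)

/-- Multi-indices, the exponents of monomials in the derivations. -/
abbrev MIdx (m : ℕ) : Type := Fin m → ℕ

/-- The length of a multi-index. -/
def MIdx.len {m : ℕ} (s : MIdx m) : ℕ := ∑ l, s l

section DifferentialRings

variable {m : ℕ}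

/-- The operator `∂ ^ s = ∂₁ ^ s₁ ⋯ ∂ₘ ^ sₘ`. -/
noncomputable def dPow {A : Type*} [CommRing A] [DiffRing m A] (s : MIdx m) : A →ₗ[ℤ] A :=
  ((List.finRange m).map fun l =>
    ((DiffRing.d l : Derivation ℤ A A) : Module.End ℤ A) ^ s l).prod

/-- Equality modulo total derivatives: `a ∼ b` iff `a - b` lies in `Im ∂₁ + ⋯ + Im ∂ₘ`. -/
def TotEq (m : ℕ) {A : Type*} [CommRing A] [DiffRing m A] (a b : A) : Prop :=
  ∃ w : Fin m → A, a - b = ∑ l, DiffRing.d l (w l)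

/-- `φ : A → B` makes `B` a differential ring extension of `A`. -/
structure IsDiffExt (m : ℕ) {A B : Type*} [CommRing A] [CommRing B] [DiffRing m A] [DiffRing m B]
    (φ : A →+* B) : Prop where
  injective : Function.Injective φ
  map_d : ∀ (l : Fin m) (a : A), φ (DiffRing.d l a) = DiffRing.d l (φ a)

/-- A derivation of the coefficient ring, applied to the coefficients of a polynomial. -/
noncomputable def coeffDer {ι S : Type*} [CommRing S] (D : Derivation ℤ S S) :
    Derivation ℤ (MvPolynomial ι S) (MvPolynomial ι S) :=
  have key : ∀ (p : MvPolynomial ι S) (t : ι →₀ ℕ),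
      coeff t (∑ s ∈ p.support, monomial s (D (coeff s p))) = D (coeff t p) := by
    classical
    intro p t
    rw [coeff_sum]
    simp only [coeff_monomial]
    rw [Finset.sum_ite_eq' p.support t]
    split_ifs with h
    · rfl
    · rw [notMem_support_iff.mp h, map_zero]
  Derivation.mk'
    (AddMonoidHom.toIntLinearMap
      (AddMonoidHom.mk' (fun p => ∑ s ∈ p.support, monomial s (D (coeff s p))) (by
        intro p q
        ext t
        rw [coeff_add, key, key, key, coeff_add, map_add])))
    (by
      classical
      intro p q
      simp only [AddMonoidHom.coe_toIntLinearMap, AddMonoidHom.mk'_apply, smul_eq_mul]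
      ext t
      rw [key, coeff_add, coeff_mul, coeff_mul, mul_comm q, coeff_mul, map_sum,
        ← Finset.sum_add_distrib]
      refine Finset.sum_congr rfl fun x _ => ?_
      rw [key, key, Derivation.leibniz, smul_eq_mul, smul_eq_mul, mul_comm (coeff x.2 q)])

theorem coeff_coeffDer {ι S : Type*} [CommRing S] (D : Derivation ℤ S S) (p : MvPolynomial ι S)
    (t : ι →₀ ℕ) : coeff t (coeffDer D p) = D (coeff t p) := by
  classical
  change coeff t (∑ s ∈ p.support, monomial s (D (coeff s p))) = D (coeff t p)
  rw [coeff_sum]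
  simp only [coeff_monomial]
  rw [Finset.sum_ite_eq' p.support t]
  split_ifs with h
  · rfl
  · rw [notMem_support_iff.mp h, map_zero]

theorem coeffDer_C {ι S : Type*} [CommRing S] (D : Derivation ℤ S S) (a : S) :
    coeffDer D (C a : MvPolynomial ι S) = C (D a) := by
  classical
  ext t
  rw [coeff_coeffDer, coeff_C, coeff_C]
  split_ifs <;> simp

theorem coeffDer_X {ι S : Type*} [CommRing S] (D : Derivation ℤ S S) (i : ι) :
    coeffDer D (X i : MvPolynomial ι S) = 0 := by
  classical
  ext t
  rw [coeff_coeffDer, coeff_X, coeff_zero]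
  split_ifs <;> simp

/-- The ring `S[uᵢ^(s)]`, `1 ≤ i ≤ N`, `s` a multi-index, of differential polynomials. -/
abbrev Jet (m N : ℕ) (S : Type*) [CommRing S] := MvPolynomial (Fin N × MIdx m) S

/-- The total derivative `∂_l` on `S[uᵢ^(s)]`: it extends the derivation of `S` and maps `uᵢ^(s)`
to `uᵢ^(s + e_l)`. -/
noncomputable def totalDer {N : ℕ} {S : Type*} [CommRing S] [DiffRing m S] (l : Fin m) :
    Derivation ℤ (Jet m N S) (Jet m N S) :=
  coeffDer (DiffRing.d l) +
    (mkDerivation S fun p : Fin N × MIdx m =>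
      (X (p.1, p.2 + Pi.single l 1) : Jet m N S)).restrictScalars ℤ

theorem totalDer_C {N : ℕ} {S : Type*} [CommRing S] [DiffRing m S] (l : Fin m) (a : S) :
    totalDer l (C a : Jet m N S) = C (DiffRing.d l a) := by
  simp [totalDer, coeffDer_C]

theorem totalDer_X {N : ℕ} {S : Type*} [CommRing S] [DiffRing m S] (l : Fin m)
    (p : Fin N × MIdx m) :
    totalDer l (X p : Jet m N S) = X (p.1, p.2 + Pi.single l 1) := by
  simp [totalDer, coeffDer_X, mkDerivation_X]

theorem totalDer_comm {N : ℕ} {S : Type*} [CommRing S] [DiffRing m S] (i j : Fin m)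
    (a : Jet m N S) : totalDer i (totalDer j a) = totalDer j (totalDer i a) := by
  induction a using MvPolynomial.induction_on with
  | C a => simp only [totalDer_C, DiffRing.d_comm i j]
  | add p q hp hq => simp only [map_add, hp, hq]
  | mul_X p k hp =>
    simp only [Derivation.leibniz, map_add, totalDer_X, smul_eq_mul, hp]
    rw [add_right_comm k.2]
    ring

noncomputable instance instDiffRingJet {N : ℕ} {S : Type*} [CommRing S] [DiffRing m S] :
    DiffRing m (MvPolynomial (Fin N × MIdx m) S) where
  d := totalDer
  d_comm := totalDer_comm

/-- The element `uᵢ = uᵢ^(0)` of `S[uᵢ^(s)]`. -/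
noncomputable def uGen {N : ℕ} {S : Type*} [CommRing S] (i : Fin N) : Jet m N S := X (i, 0)

/-- The variational derivative `δH/δuᵢ = ∑ₛ (-∂)^s (∂H/∂uᵢ^(s))`. -/
noncomputable def varDer {N : ℕ} {S : Type*} [CommRing S] [DiffRing m S] (H : Jet m N S)
    (i : Fin N) : Jet m N S :=
  ∑ p ∈ H.vars, if p.1 = i then (-1) ^ p.2.len * dPow p.2 (pderiv p H) else 0

/-- The `S`-linear evolution derivation of `S[uᵢ^(s)]` with `uᵢ ↦ Qᵢ`, that is,
`uᵢ^(s) ↦ ∂^s Qᵢ`. -/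
noncomputable def evolution {N : ℕ} {S : Type*} [CommRing S] [DiffRing m S]
    (Q : Fin N → Jet m N S) : Derivation S (Jet m N S) (Jet m N S) :=
  mkDerivation S fun p => dPow p.2 (Q p.1)

/-- The pairing `⟨w, y⟩ = ∑ᵢ wᵢ yᵢ`. -/
def pairing {N : ℕ} {A : Type*} [CommRing A] (w y : Fin N → A) : A := ∑ i, w i * y i

end DifferentialRings

section Operators

/-- Coefficients of a bilinear differential operator `R^N × R^N → R^N`: `c k i j (s, t)` is the
coefficient of `∂^s xᵢ ∂^t yⱼ` in the `k`-th component. -/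
abbrev BiDiffOp (m N : ℕ) (R : Type*) [CommRing R] :=
  Fin N → Fin N → Fin N → (MIdx m × MIdx m →₀ R)

variable {m N : ℕ} {R A : Type*} [CommRing R] [CommRing A] [DiffRing m A]

/-- The bilinear differential operator `c` on `A^N`, for a ring `A` under `R`. -/
noncomputable def BiDiffOp.eval (φ : R →+* A) (c : BiDiffOp m N R) (x y : Fin N → A) :
    Fin N → A :=
  fun k => ∑ i, ∑ j, (c k i j).sum fun s a => φ a * dPow s.1 (x i) * dPow s.2 (y j)

/-- The dual action `x · v` for the multiplication `[x, y] = c.eval φ x y`. The operator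
`v ↦ x · v` is minus the formal adjoint of `y ↦ [x, y]`, so `⟨x · v, y⟩ ∼ -⟨v, [x, y]⟩` for
all `y`. -/
noncomputable def BiDiffOp.coad (φ : R →+* A) (c : BiDiffOp m N R) (x v : Fin N → A) :
    Fin N → A :=
  fun j => -∑ k, ∑ i, (c k i j).sum fun s a =>
    (-1) ^ s.2.len * dPow s.2 (φ a * dPow s.1 (x i) * v k)

/-- The action on `A^N` of a square matrix of differential operators `∑ₛ aₛ ∂^s` with
coefficients in a ring over which `A` lies. -/
noncomputable def matAct (φ : R →+* A) (B : Matrix (Fin N) (Fin N) (MIdx m →₀ R))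
    (y : Fin N → A) : Fin N → A :=
  fun i => ∑ j, (B i j).sum fun s a => φ a * dPow s (y j)

/-- The multiplication on `G ⊕ G*` that extends the multiplications `c` on `G` and `c'` on `G*`
through the dual actions:
`[(x, u), (y, v)] = ([x, y] + u · y - v · x, [u, v] + x · v - y · u)`. -/
noncomputable def doubleBracket (φ : R →+* A) (c c' : BiDiffOp m N R)
    (a b : (Fin N → A) × (Fin N → A)) : (Fin N → A) × (Fin N → A) :=
  (c.eval φ a.1 b.1 + c'.coad φ a.2 b.1 - c'.coad φ b.2 a.1,
   c'.eval φ a.2 b.2 + c.coad φ a.1 b.2 - c.coad φ b.1 a.2)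

end Operators

section LieAlgebras

variable {m N : ℕ} {R : Type u} [CommRing R] [DiffRing m R]

/-- `c` makes `R^N` a differential Lie algebra: skewsymmetry and the Jacobi identity hold over
every differential extension of `R`. -/
structure IsDiffLie (c : BiDiffOp m N R) : Prop where
  skew : ∀ (S : Type u) [CommRing S] [DiffRing m S] (φ : R →+* S), IsDiffExt m φ →
    ∀ x y : Fin N → S, c.eval φ x y = -c.eval φ y x
  jacobi : ∀ (S : Type u) [CommRing S] [DiffRing m S] (φ : R →+* S), IsDiffExt m φ →
    ∀ x y z : Fin N → S, c.eval φ (c.eval φ x y) z + c.eval φ (c.eval φ y z) x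
      + c.eval φ (c.eval φ z x) y = 0

/-- `c` and `c'` are Lie algebra structures on `G = R^N` and on `G* = R^N` that make `G ⊕ G*` a
differential Lie algebra. -/
structure IsDiffLiePair (c c' : BiDiffOp m N R) : Prop where
  left : IsDiffLie c
  right : IsDiffLie c'
  double : ∀ (S : Type u) [CommRing S] [DiffRing m S] (φ : R →+* S), IsDiffExt m φ →
    ∀ x y z : (Fin N → S) × (Fin N → S),
      doubleBracket φ c c' (doubleBracket φ c c' x y) z
        + doubleBracket φ c c' (doubleBracket φ c c' y z) x
        + doubleBracket φ c c' (doubleBracket φ c c' z x) y = 0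

end LieAlgebras

section Brackets

variable {m N : ℕ} {R S : Type u} [CommRing R] [DiffRing m R] [CommRing S] [DiffRing m S]

/-- The bracket `{H, F} = (δF/δu)ᵗ B (δH/δu)` on `S[uᵢ^(s)]` of a matrix `B` of differential
operators with coefficients in `R[uᵢ^(s)]`. It matters only modulo total derivatives. -/
noncomputable def poisson (φ : R →+* S) (B : Matrix (Fin N) (Fin N) (MIdx m →₀ Jet m N R))
    (H F : Jet m N S) : Jet m N S :=
  pairing (varDer F) (matAct (MvPolynomial.map φ) B (varDer H))

/-- `B` is a Hamiltonian matrix: it is skewsymmetric (`B† = -B`, that is, `zᵗ B(y) ∼ -yᵗ B(z)`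
over every differential extension) and its bracket satisfies the Jacobi identity modulo total
derivatives. -/
structure IsHamiltonian (B : Matrix (Fin N) (Fin N) (MIdx m →₀ Jet m N R)) : Prop where
  skew : ∀ (A : Type u) [CommRing A] [DiffRing m A] (φ : Jet m N R →+* A), IsDiffExt m φ →
    ∀ y z : Fin N → A, TotEq m (pairing z (matAct φ B y)) (-pairing y (matAct φ B z))
  jacobi : ∀ H F G : Jet m N R,
    TotEq m (poisson (RingHom.id R) B (poisson (RingHom.id R) B H F) G
      + poisson (RingHom.id R) B (poisson (RingHom.id R) B F G) H
      + poisson (RingHom.id R) B (poisson (RingHom.id R) B G H) F) 0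

/-- The evolution derivation `X^` of `S[uᵢ^(s)]` generated by `x ∈ S^N` through the coadjoint
action: `X^(u) = x · u`. -/
noncomputable def hat (φ : R →+* S) (c : BiDiffOp m N R) (x : Fin N → S) :
    Derivation S (Jet m N S) (Jet m N S) :=
  evolution (c.coad ((MvPolynomial.C : S →+* Jet m N S).comp φ) (fun i => MvPolynomial.C (x i))
    uGen)

/-- `w = H^~`: the defining relation `⟨w, x⟩ ∼ X^(H)` for all `x` in the Lie algebra, over every
differential extension `T` of `S`. -/
def IsTilde (φ : R →+* S) (c : BiDiffOp m N R) (H : Jet m N S) (w : Fin N → Jet m N S) : Prop :=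
  ∀ (T : Type u) [CommRing T] [DiffRing m T] (ψ : S →+* T), IsDiffExt m ψ →
    ∀ x : Fin N → T,
      TotEq m (pairing (fun i => MvPolynomial.map ψ (w i)) (fun i => MvPolynomial.C (x i)))
        (hat (ψ.comp φ) c x (MvPolynomial.map ψ H))

/-- The relation of infinitesimal Hamiltonian action for `x`, `H`, `F`:
`X^({H, F}) - {X^(H), F} - {H, X^(F)} ∼ ⟨[H^~, F^~], x⟩`. -/
def ActionRel (φ : R →+* S) (c c' : BiDiffOp m N R)
    (B : Matrix (Fin N) (Fin N) (MIdx m →₀ Jet m N R)) (x : Fin N → S) (H F : Jet m N S) : Prop :=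
  ∃ wH wF : Fin N → Jet m N S, IsTilde φ c H wH ∧ IsTilde φ c F wF ∧
    TotEq m
      (hat φ c x (poisson φ B H F) - poisson φ B (hat φ c x H) F - poisson φ B H (hat φ c x F))
      (pairing (c'.eval ((MvPolynomial.C : S →+* Jet m N S).comp φ) wH wF)
        (fun i => MvPolynomial.C (x i)))

/-- The linear Hamiltonian `∑ᵢ uᵢ yᵢ`. -/
noncomputable def linearHam (y : Fin N → S) : Jet m N S :=
  pairing uGen (fun i => MvPolynomial.C (y i))

end Brackets

end DiffHam

/-!
Write `h = δH/δu` and `f = δF/δu`. The evolution derivation `X^` commutes with all `∂_l`, and its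
characteristic `x · u` is linear in `u`, with Fréchet derivative `v ↦ x · v`, whose formal adjoint
is `-[x, ·]`. Hence `δ(X^H)/δu = X^(h) - [x, h]` (`varDer_hat`). The first variation formula and the
skewsymmetry of the bracket give `H^~ = -h · u` (`isTilde_coad`), and the defining relation
determines `H^~` (`IsTilde.unique`). Substituting all this in the criterion, the terms containing
`X^(h)` and `X^(f)` cancel, and the criterion becomes `Φ(h, f) ∼ 0`, where
`Φ(h, f) = fᵗ X^(B) h + [x, f]ᵗ B h + fᵗ B [x, h] - ⟨[h · u, f · u], x⟩`
is a bilinear differential expression in `h` and `f` (`actionDefect`, `actionRel_iff`).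

A linear Hamiltonian `⟨u, y⟩` has variational derivative `y`. Apply the criterion for linear
Hamiltonians over the extension `S[uᵢ^(s)]` of `S`, with `h` and `f` as the coefficient vectors. It
says `Φ(h, f) ∼ 0` in `S[uᵢ^(s)][vᵢ^(s)]`, where `B` and the dual actions involve the new generators
`vᵢ^(s)`. The differential homomorphism `vᵢ^(s) ↦ uᵢ^(s)` over `S[uᵢ^(s)]` preserves `∼` and sends
this to `Φ(h, f) ∼ 0` in `S[uᵢ^(s)]` (`jetFold_actionDefect`), which is the criterion for `H` and
`F`.

The formulas of the calculus of variations are needed over arbitrary commutative rings. They all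
come from one operator, `frechetAdj i P g = ∑ₛ (-∂)^s (∂P/∂uᵢ^(s) g)`. For fixed `i` it satisfies a
product rule in `P`, `frechetAdj_mul`, so identities that involve it are checked for all `g` at once by
induction on `P`.
-/

namespace DiffHam

open MvPolynomial

/-! ### Powers of the derivations and integration by parts -/

section DifferentialRings

variable {m : ℕ} {A A' : Type*} [CommRing A] [DiffRing m A] [CommRing A'] [DiffRing m A']

theorem list_prod_pow_add_single {M ι : Type*} [Monoid M] [DecidableEq ι] (f : ι → M)
    (hf : ∀ i j, Commute (f i) (f j)) (s : ι → ℕ) (k : ι) (L : List ι) (hL : L.Nodup) :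
    (L.map fun l => f l ^ (s + Pi.single k 1 : ι → ℕ) l).prod
      = if k ∈ L then f k * (L.map fun l => f l ^ s l).prod
        else (L.map fun l => f l ^ s l).prod := by
  induction L with
  | nil => simp
  | cons a L ih =>
    obtain ⟨ha, hL⟩ := List.nodup_cons.mp hL
    simp only [List.map_cons, List.prod_cons, ih hL, List.mem_cons]
    by_cases h : k = a
    · subst h
      simp [ha, pow_succ', mul_assoc]
    · have h' : a ≠ k := fun e => h e.symm
      by_cases hk : k ∈ L
      · simp only [hk, or_true, if_true, Pi.add_apply, Pi.single_eq_of_ne h', add_zero]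
        rw [← mul_assoc, ← mul_assoc, ((hf k a).pow_right (s a)).eq]
      · simp [hk, h]

@[simp]
theorem dPow_zero (a : A) : dPow (0 : MIdx m) a = a := by
  have : (List.map (fun _ : Fin m => (1 : Module.End ℤ A)) (List.finRange m)).prod = 1 := by
    apply List.prod_eq_one; simp
  simp [dPow]

theorem dPow_add_single (s : MIdx m) (l : Fin m) (a : A) :
    dPow (s + Pi.single l 1) a = DiffRing.d l (dPow s a) := by
  have := list_prod_pow_add_single
    (fun l : Fin m => ((DiffRing.d l : Derivation ℤ A A) : Module.End ℤ A))
    (fun i j => LinearMap.ext fun a => DiffRing.d_comm i j a) s l (List.finRange m)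
    (List.nodup_finRange m)
  rw [if_pos (List.mem_finRange l)] at this
  exact LinearMap.congr_fun this a

theorem MIdx.len_zero : MIdx.len (0 : MIdx m) = 0 := by simp [MIdx.len]

theorem MIdx.len_add_single (s : MIdx m) (l : Fin m) :
    MIdx.len (s + Pi.single l 1) = MIdx.len s + 1 := by
  simp [MIdx.len, Finset.sum_add_distrib]

theorem MIdx.induction {P : MIdx m → Prop} (zero : P 0)
    (add_single : ∀ s l, P s → P (s + Pi.single l 1)) (s : MIdx m) : P s := by
  induction h : MIdx.len s generalizing s with
  | zero =>
    have : s = 0 := by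
      funext l
      exact (Finset.sum_eq_zero_iff.mp h) l (Finset.mem_univ l)
    exact this ▸ zero
  | succ n ih =>
    obtain ⟨l, hl⟩ : ∃ l, s l ≠ 0 := by
      by_contra! hs
      rw [show s = 0 from funext hs, MIdx.len_zero] at h
      omega
    have hs : s = (s - Pi.single l 1) + Pi.single l 1 := by
      funext k
      by_cases hk : k = l
      · subst hk
        simp
        omega
      · simp [hk]
    rw [hs] at h ⊢
    rw [MIdx.len_add_single] at h
    exact add_single _ _ (ih _ (by omega))

theorem dPow_d (s : MIdx m) (l : Fin m) (a : A) :
    dPow s (DiffRing.d l a) = DiffRing.d l (dPow s a) := by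
  induction s using MIdx.induction with
  | zero => simp
  | add_single s k ih => rw [dPow_add_single, dPow_add_single, ih, DiffRing.d_comm]

/-- The operator `(-∂) ^ s`, the formal adjoint of `∂ ^ s`. -/
noncomputable def negDPow (s : MIdx m) : A →+ A :=
  (AddMonoidHom.mulLeft ((-1) ^ s.len)).comp (dPow s : A →ₗ[ℤ] A).toAddMonoidHom

theorem negDPow_apply (s : MIdx m) (a : A) : negDPow s a = (-1) ^ s.len * dPow s a := rfl

@[simp]
theorem negDPow_zero (a : A) : negDPow (0 : MIdx m) a = a := by
  simp [negDPow_apply, MIdx.len_zero]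

theorem negDPow_add_single (s : MIdx m) (l : Fin m) (a : A) :
    negDPow (s + Pi.single l 1) a = -negDPow s (DiffRing.d l a) := by
  rw [negDPow_apply, negDPow_apply, dPow_add_single, dPow_d, MIdx.len_add_single, pow_succ]
  ring

/-- The subgroup `Im ∂₁ + ⋯ + Im ∂ₘ` of total derivatives. -/
def totSub (m : ℕ) (A : Type*) [CommRing A] [DiffRing m A] : AddSubgroup A :=
  AddMonoidHom.range (AddMonoidHom.mk' (fun w : Fin m → A => ∑ l, DiffRing.d l (w l))
    fun v w => by simp [Finset.sum_add_distrib])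

/-- The projection of `A` onto its quotient by the total derivatives. -/
def modTot (m : ℕ) (A : Type*) [CommRing A] [DiffRing m A] : A →+ A ⧸ totSub m A :=
  QuotientAddGroup.mk' _

theorem totEq_iff {a b : A} : TotEq m a b ↔ modTot m A a = modTot m A b := by
  rw [modTot, QuotientAddGroup.mk'_apply, QuotientAddGroup.mk'_apply, eq_comm,
    QuotientAddGroup.eq, totSub, AddMonoidHom.mem_range, neg_add_eq_sub]
  exact ⟨fun ⟨w, hw⟩ => ⟨w, hw.symm⟩, fun ⟨w, hw⟩ => ⟨w, hw.symm⟩⟩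

theorem modTot_d (l : Fin m) (a : A) : modTot m A (DiffRing.d l a) = 0 := by
  rw [← map_zero (modTot m A), ← totEq_iff]
  refine ⟨Pi.single l a, ?_⟩
  rw [Finset.sum_eq_single l]
  · simp
  · intro k _ hk
    simp [hk]
  · simp

/-- Integration by parts. -/
theorem modTot_dPow_mul (s : MIdx m) (a b : A) :
    modTot m A (dPow s a * b) = modTot m A (a * negDPow s b) := by
  induction s using MIdx.induction generalizing b with
  | zero => simp
  | add_single s l ih =>
    have := modTot_d l (dPow s a * b)
    rw [Derivation.leibniz, map_add, smul_eq_mul, smul_eq_mul, ih, add_comm,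
      mul_comm b] at this
    rw [dPow_add_single, negDPow_add_single, mul_neg, map_neg]
    exact eq_neg_of_add_eq_zero_left this

theorem modTot_mul_dPow (s : MIdx m) (a b : A) :
    modTot m A (a * dPow s b) = modTot m A (negDPow s a * b) := by
  rw [mul_comm, modTot_dPow_mul, mul_comm]

section Hom

variable {θ : A →+* A'} (hθ : ∀ (l : Fin m) (a : A), θ (DiffRing.d l a) = DiffRing.d l (θ a))
include hθ

theorem map_dPow (s : MIdx m) (a : A) : θ (dPow s a) = dPow s (θ a) := by
  induction s using MIdx.induction with
  | zero => simp
  | add_single s l ih => rw [dPow_add_single, dPow_add_single, hθ, ih]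

theorem map_negDPow (s : MIdx m) (a : A) : θ (negDPow s a) = negDPow s (θ a) := by
  rw [negDPow_apply, negDPow_apply, map_mul, map_pow, map_neg, map_one, map_dPow hθ]

theorem TotEq.map {a b : A} (h : TotEq m a b) : TotEq m (θ a) (θ b) := by
  obtain ⟨w, hw⟩ := h
  exact ⟨fun l => θ (w l), by simp only [← map_sub, hw, map_sum, hθ]⟩

end Hom

end DifferentialRings

/-! ### Differential polynomials and evolution derivations -/

section Jets

variable {m N : ℕ} {S T : Type*} [CommRing S] [DiffRing m S] [CommRing T] [DiffRing m T]

theorem d_C (l : Fin m) (a : S) :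
    DiffRing.d l (C a : Jet m N S) = C (DiffRing.d l a) := totalDer_C l a

theorem d_X (l : Fin m) (p : Fin N × MIdx m) :
    DiffRing.d l (X p : Jet m N S) = X (p.1, p.2 + Pi.single l 1) := totalDer_X l p

/-- A ring homomorphism from a ring of differential polynomials is differential if it is so on the
coefficients and on the generators. -/
theorem map_d_of_generators {A : Type*} [CommRing A] [DiffRing m A] {θ : Jet m N S →+* A}
    (hC : ∀ (l : Fin m) (a : S), θ (C (DiffRing.d l a)) = DiffRing.d l (θ (C a)))
    (hX : ∀ (l : Fin m) (p : Fin N × MIdx m),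
      θ (X (p.1, p.2 + Pi.single l 1)) = DiffRing.d l (θ (X p)))
    (l : Fin m) (P : Jet m N S) : θ (DiffRing.d l P) = DiffRing.d l (θ P) := by
  induction P using MvPolynomial.induction_on with
  | C a => rw [d_C, hC]
  | add P Q hP hQ => simp only [map_add, hP, hQ]
  | mul_X P p hP =>
    simp only [Derivation.leibniz, map_add, map_mul, smul_eq_mul, hP, d_X, hX]

theorem map_map_d {ψ : S →+* T}
    (hψ : ∀ (l : Fin m) (a : S), ψ (DiffRing.d l a) = DiffRing.d l (ψ a))
    (l : Fin m) (P : Jet m N S) :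
    MvPolynomial.map ψ (DiffRing.d l P) = DiffRing.d l (MvPolynomial.map ψ P) :=
  map_d_of_generators (fun l a => by rw [map_C, map_C, d_C, hψ])
    (fun l p => by rw [map_X, map_X, d_X]) l P

theorem isDiffExt_C : IsDiffExt m (C : S →+* Jet m N S) where
  injective := C_injective _ _
  map_d l a := (d_C l a).symm

theorem IsDiffExt.comp {R : Type*} [CommRing R] [DiffRing m R] {ψ : S →+* T} {φ : R →+* S}
    (hψ : IsDiffExt m ψ) (hφ : IsDiffExt m φ) : IsDiffExt m (ψ.comp φ) where
  injective := by
    rw [RingHom.coe_comp]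
    exact hψ.injective.comp hφ.injective
  map_d l a := by simp [hφ.map_d, hψ.map_d]

section Evolution

variable (Q : Fin N → Jet m N S)

@[simp]
theorem evolution_X (p : Fin N × MIdx m) : evolution Q (X p) = dPow p.2 (Q p.1) :=
  mkDerivation_X _ _ _

@[simp]
theorem evolution_C (a : S) : evolution Q (C a) = 0 :=
  (evolution Q).map_algebraMap a

theorem evolution_d (l : Fin m) (P : Jet m N S) :
    evolution Q (DiffRing.d l P) = DiffRing.d l (evolution Q P) := by
  induction P using MvPolynomial.induction_on with
  | C a => simp [d_C]
  | add P P' hP hP' => simp only [map_add, hP, hP']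
  | mul_X P p hP =>
    simp only [Derivation.leibniz, map_add, smul_eq_mul, hP, d_X, evolution_X, dPow_add_single]
    ring

theorem evolution_dPow (s : MIdx m) (P : Jet m N S) :
    evolution Q (dPow s P) = dPow s (evolution Q P) := by
  induction s using MIdx.induction with
  | zero => simp
  | add_single s l ih => rw [dPow_add_single, dPow_add_single, evolution_d, ih]

theorem evolution_negDPow (s : MIdx m) (P : Jet m N S) :
    evolution Q (negDPow s P) = negDPow s (evolution Q P) := by
  have h : evolution Q ((-1 : Jet m N S) ^ s.len) = 0 := by
    rw [show ((-1 : Jet m N S) ^ s.len) = C ((-1) ^ s.len) by simp, evolution_C]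
  rw [negDPow_apply, negDPow_apply, Derivation.leibniz, h, evolution_dPow, smul_zero, add_zero,
    smul_eq_mul]

end Evolution

/-! ### Adjoint Fréchet derivatives and variational derivatives -/

/-- `frechetAdj i P g = ∑ₛ (-∂)^s (∂P/∂uᵢ^(s) g)`, the `i`-th component of the formal adjoint of
the Fréchet derivative of `P`, applied to `g`. At `g = 1` it is the variational derivative. -/
noncomputable def frechetAdj (i : Fin N) : Jet m N S →+ Jet m N S →+ Jet m N S :=
  AddMonoidHom.mk' (fun P => ∑ p ∈ P.vars, if p.1 = i then
      (negDPow p.2).comp (AddMonoidHom.mulLeft (pderiv p P)) else 0) (by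
    classical
    have key : ∀ (P : Jet m N S) (V : Finset (Fin N × MIdx m)), P.vars ⊆ V →
        (∑ p ∈ P.vars, if p.1 = i then
          (negDPow p.2).comp (AddMonoidHom.mulLeft (pderiv p P)) else 0)
        = ∑ p ∈ V, if p.1 = i then
          (negDPow p.2).comp (AddMonoidHom.mulLeft (pderiv p P)) else 0 := by
      intro P V hV
      refine Finset.sum_subset hV fun p _ hp => ?_
      rw [pderiv_eq_zero_of_notMem_vars hp]
      ext g
      split_ifs <;> simp
    intro P Q
    rw [key _ _ (vars_add_subset P Q), key P _ Finset.subset_union_left,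
      key Q _ Finset.subset_union_right, ← Finset.sum_add_distrib]
    refine Finset.sum_congr rfl fun p _ => ?_
    split_ifs
    · ext g
      simp [add_mul]
    · simp)

theorem frechetAdj_eq_sum (i : Fin N) (P g : Jet m N S) (V : Finset (Fin N × MIdx m))
    (hV : P.vars ⊆ V) :
    frechetAdj i P g = ∑ p ∈ V, if p.1 = i then negDPow p.2 (pderiv p P * g) else 0 := by
  have h : frechetAdj i P g
      = ∑ p ∈ P.vars, if p.1 = i then negDPow p.2 (pderiv p P * g) else 0 := by
    rw [frechetAdj, AddMonoidHom.mk'_apply, AddMonoidHom.finsetSum_apply]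
    refine Finset.sum_congr rfl fun p _ => ?_
    split_ifs <;> simp
  rw [h]
  refine Finset.sum_subset hV fun p _ hp => ?_
  rw [pderiv_eq_zero_of_notMem_vars hp]
  split_ifs <;> simp

theorem varDer_eq_frechetAdj (P : Jet m N S) (i : Fin N) : varDer P i = frechetAdj i P 1 := by
  rw [frechetAdj_eq_sum i P 1 _ subset_rfl, varDer]
  simp [negDPow_apply]

@[simp]
theorem frechetAdj_C (i : Fin N) (a : S) (g : Jet m N S) : frechetAdj i (C a) g = 0 := by
  rw [frechetAdj_eq_sum i _ g ∅ (by simp)]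
  simp

theorem frechetAdj_X (i : Fin N) (p : Fin N × MIdx m) (g : Jet m N S) :
    frechetAdj i (X p) g = if p.1 = i then negDPow p.2 g else 0 := by
  classical
  have hV : (X p : Jet m N S).vars ⊆ {p} := by
    intro q hq
    obtain ⟨d, hd, hq⟩ := (mem_vars_iff_mem_support q).mp hq
    rw [Finset.mem_singleton.mp (support_monomial_subset hd)] at hq
    exact Finsupp.support_single_subset hq
  rw [frechetAdj_eq_sum i _ g _ hV, Finset.sum_singleton, pderiv_X_self, one_mul]

theorem frechetAdj_mul (i : Fin N) (P Q g : Jet m N S) :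
    frechetAdj i (P * Q) g = frechetAdj i P (Q * g) + frechetAdj i Q (P * g) := by
  classical
  rw [frechetAdj_eq_sum i _ g _ (vars_mul P Q),
    frechetAdj_eq_sum i P _ _ Finset.subset_union_left,
    frechetAdj_eq_sum i Q _ _ Finset.subset_union_right, ← Finset.sum_add_distrib]
  refine Finset.sum_congr rfl fun p _ => ?_
  split_ifs
  · rw [Derivation.leibniz, ← map_add, smul_eq_mul, smul_eq_mul]
    ring_nf
  · simp

/-- The Fréchet derivative of `∂_l P` is `∂_l` after that of `P`, and `∂_l` has adjoint `-∂_l`. -/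
theorem frechetAdj_d (i : Fin N) (l : Fin m) (P g : Jet m N S) :
    frechetAdj i (DiffRing.d l P) g = -frechetAdj i P (DiffRing.d l g) := by
  induction P using MvPolynomial.induction_on generalizing g with
  | C a => simp [d_C]
  | add P Q hP hQ => simp only [map_add, AddMonoidHom.add_apply, hP, hQ, neg_add]
  | mul_X P p hP =>
    have hX : ∀ g, frechetAdj i (DiffRing.d l (X p : Jet m N S)) g
        = -frechetAdj i (X p) (DiffRing.d l g) := by
      intro g
      rw [d_X, frechetAdj_X, frechetAdj_X]
      split_ifs
      · rw [negDPow_add_single]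
      · simp
    rw [Derivation.leibniz]
    simp only [smul_eq_mul, map_add, AddMonoidHom.add_apply, frechetAdj_mul, hP, hX,
      Derivation.leibniz]
    simp only [mul_comm]
    ring

theorem frechetAdj_dPow (i : Fin N) (s : MIdx m) (P g : Jet m N S) :
    frechetAdj i (dPow s P) g = frechetAdj i P (negDPow s g) := by
  induction s using MIdx.induction generalizing g with
  | zero => simp
  | add_single s l ih =>
    rw [dPow_add_single, frechetAdj_d, ih, negDPow_add_single, map_neg]

theorem frechetAdj_negDPow (i : Fin N) (s : MIdx m) (P g : Jet m N S) :
    frechetAdj i (negDPow s P) g = frechetAdj i P (dPow s g) := by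
  have h : ((-1 : Jet m N S) ^ s.len) = C ((-1) ^ s.len) := by simp
  rw [negDPow_apply, h, frechetAdj_mul, frechetAdj_C, zero_add, frechetAdj_dPow, negDPow_apply, ← h]
  have : dPow s ((-1) ^ s.len * g) = (-1) ^ s.len * dPow s g := by
    rcases neg_one_pow_eq_or (Jet m N S) s.len with h | h <;> simp [h]
  rw [this, ← mul_assoc, ← mul_pow]
  simp

theorem map_frechetAdj {ψ : S →+* T}
    (hψ : ∀ (l : Fin m) (a : S), ψ (DiffRing.d l a) = DiffRing.d l (ψ a))
    (i : Fin N) (P g : Jet m N S) :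
    MvPolynomial.map ψ (frechetAdj i P g)
      = frechetAdj i (MvPolynomial.map ψ P) (MvPolynomial.map ψ g) := by
  induction P using MvPolynomial.induction_on generalizing g with
  | C a => simp
  | add P Q hP hQ => simp only [map_add, AddMonoidHom.add_apply, hP, hQ]
  | mul_X P p hP =>
    rw [frechetAdj_mul, map_add, hP, (MvPolynomial.map ψ).map_mul, (MvPolynomial.map ψ).map_mul,
      frechetAdj_mul, map_X, frechetAdj_X,
      frechetAdj_X]
    split_ifs
    · rw [map_negDPow (map_map_d hψ), (MvPolynomial.map ψ).map_mul]
    · simp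

theorem map_varDer {ψ : S →+* T}
    (hψ : ∀ (l : Fin m) (a : S), ψ (DiffRing.d l a) = DiffRing.d l (ψ a))
    (P : Jet m N S) (i : Fin N) :
    MvPolynomial.map ψ (varDer P i) = varDer (MvPolynomial.map ψ P) i := by
  rw [varDer_eq_frechetAdj, varDer_eq_frechetAdj, map_frechetAdj hψ, map_one]

/-- The variational derivative annihilates total derivatives. -/
theorem varDer_congr {P Q : Jet m N S} (h : TotEq m P Q) :
    varDer P = varDer Q := by
  obtain ⟨w, hw⟩ := h
  rw [sub_eq_iff_eq_add] at hw
  funext i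
  have h1 : ∀ l : Fin m, DiffRing.d l (1 : Jet m N S) = 0 := fun l => Derivation.map_one_eq_zero _
  rw [varDer_eq_frechetAdj, varDer_eq_frechetAdj, hw, map_add, map_sum, AddMonoidHom.add_apply,
    AddMonoidHom.finsetSum_apply]
  simp [frechetAdj_d, h1]

theorem varDer_linearHam {S : Type u} [CommRing S] [DiffRing m S] (y : Fin N → S) :
    varDer (linearHam y : Jet m N S) = fun i => C (y i) := by
  funext i
  rw [varDer_eq_frechetAdj, linearHam, pairing, map_sum, AddMonoidHom.finsetSum_apply]
  simp [frechetAdj_mul, uGen, frechetAdj_X]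

/-- The first variation formula. -/
theorem modTot_evolution_mul (Q : Fin N → Jet m N S) (P g : Jet m N S) :
    modTot m _ (evolution Q P * g) = modTot m _ (∑ j, Q j * frechetAdj j P g) := by
  induction P using MvPolynomial.induction_on generalizing g with
  | C a => simp
  | add P P' hP hP' =>
    simp only [map_add, add_mul, AddMonoidHom.add_apply, mul_add, Finset.sum_add_distrib, hP, hP']
  | mul_X P p hP =>
    rw [Derivation.leibniz, smul_eq_mul, smul_eq_mul, add_mul, map_add, evolution_X,
      mul_comm P, mul_assoc, modTot_dPow_mul, mul_comm (X p), mul_assoc, hP]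
    simp only [frechetAdj_mul, frechetAdj_X, mul_add, Finset.sum_add_distrib, map_add, mul_ite,
      mul_zero, Finset.sum_ite_eq, Finset.mem_univ, if_true]
    exact add_comm _ _

theorem modTot_evolution (Q : Fin N → Jet m N S) (P : Jet m N S) :
    modTot m _ (evolution Q P) = modTot m _ (pairing Q (varDer P)) := by
  simpa [pairing, varDer_eq_frechetAdj] using modTot_evolution_mul Q P 1

/-- An evolution derivation applied to an adjoint Fréchet derivative. The induction on `P` needs the
statement for arbitrary `g`, not just for `g = 1`. -/
theorem frechetAdj_evolution (Q : Fin N → Jet m N S) (i : Fin N) (P g : Jet m N S) :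
    frechetAdj i (evolution Q P) g = evolution Q (frechetAdj i P g)
      - frechetAdj i P (evolution Q g) + ∑ j, frechetAdj i (Q j) (frechetAdj j P g) := by
  induction P using MvPolynomial.induction_on generalizing g with
  | C a => simp
  | add P P' hP hP' =>
    simp only [map_add, AddMonoidHom.add_apply, Finset.sum_add_distrib, hP, hP']
    ring
  | mul_X P p hP =>
    have hX : ∀ g, frechetAdj i (evolution Q (X p)) g = evolution Q (frechetAdj i (X p) g)
        - frechetAdj i (X p) (evolution Q g)
        + ∑ j, frechetAdj i (Q j) (frechetAdj j (X p) g) := by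
      intro g
      have : ∑ j, frechetAdj i (Q j) (frechetAdj j (X p) g)
          = frechetAdj i (Q p.1) (negDPow p.2 g) := by
        rw [Finset.sum_eq_single p.1]
        · simp [frechetAdj_X]
        · intro j _ hj
          simp [frechetAdj_X, hj.symm]
        · simp
      rw [this, evolution_X, frechetAdj_dPow, frechetAdj_X, frechetAdj_X]
      split_ifs
      · rw [evolution_negDPow, sub_self, zero_add]
      · simp
    rw [Derivation.leibniz]
    simp only [smul_eq_mul, map_add, AddMonoidHom.add_apply, frechetAdj_mul, hP, hX,
      Derivation.leibniz, Finset.sum_add_distrib]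
    simp only [mul_comm]
    ring

/-- The variational derivative of an evolved Hamiltonian: it is the evolved variational
derivative, corrected by the adjoint of the Fréchet derivative of the characteristic. -/
theorem varDer_evolution (Q : Fin N → Jet m N S) (P : Jet m N S) (i : Fin N) :
    varDer (evolution Q P) i
      = evolution Q (varDer P i) + ∑ j, frechetAdj i (Q j) (varDer P j) := by
  have h1 : evolution Q (1 : Jet m N S) = 0 := Derivation.map_one_eq_zero _
  simp only [varDer_eq_frechetAdj]
  rw [frechetAdj_evolution, h1, map_zero, sub_zero]

end Jets

/-! ### Differential operators under homomorphisms and derivations -/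

section Operators

variable {m N : ℕ} {R A A' : Type*} [CommRing R] [CommRing A] [DiffRing m A]
  [CommRing A'] [DiffRing m A']

theorem pairing_comm (w y : Fin N → A) : pairing w y = pairing y w := by
  simp only [pairing, mul_comm]

theorem pairing_neg_left (w y : Fin N → A) : pairing (-w) y = -pairing w y := by
  simp [pairing]

theorem pairing_neg_right (w y : Fin N → A) : pairing w (-y) = -pairing w y := by
  simp [pairing]

theorem pairing_sub_left (v w y : Fin N → A) :
    pairing (v - w) y = pairing v y - pairing w y := by
  simp [pairing, sub_mul]

theorem pairing_add_right (w x y : Fin N → A) :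
    pairing w (x + y) = pairing w x + pairing w y := by
  simp [pairing, mul_add, Finset.sum_add_distrib]

theorem pairing_sub_right (w x y : Fin N → A) :
    pairing w (x - y) = pairing w x - pairing w y := by
  simp [pairing, mul_sub]

theorem map_pairing (θ : A →+* A') (w y : Fin N → A) :
    θ (pairing w y) = pairing (θ ∘ w) (θ ∘ y) := by
  simp [pairing]

theorem BiDiffOp.coad_apply (φ : R →+* A) (c : BiDiffOp m N R) (x v : Fin N → A) (j : Fin N) :
    c.coad φ x v j = -∑ k, ∑ i, (c k i j).sum fun s a =>
      negDPow s.2 (φ a * dPow s.1 (x i) * v k) := rfl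

/-- The defining property of the dual action. -/
theorem BiDiffOp.modTot_pairing_coad (φ : R →+* A) (c : BiDiffOp m N R) (x v y : Fin N → A) :
    modTot m A (pairing (c.coad φ x v) y) = -modTot m A (pairing v (c.eval φ x y)) := by
  simp only [pairing, BiDiffOp.coad_apply, BiDiffOp.eval, Finsupp.sum, neg_mul,
    Finset.sum_neg_distrib, map_neg, Finset.sum_mul, Finset.mul_sum, map_sum]
  congr 1
  rw [Finset.sum_comm]
  refine Finset.sum_congr rfl fun k _ => ?_
  rw [Finset.sum_comm]
  refine Finset.sum_congr rfl fun i _ => ?_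
  refine Finset.sum_congr rfl fun j _ => ?_
  refine Finset.sum_congr rfl fun s _ => ?_
  rw [← modTot_mul_dPow]
  congr 1
  ring

section Hom

variable {θ : A →+* A'} (hθ : ∀ (l : Fin m) (a : A), θ (DiffRing.d l a) = DiffRing.d l (θ a))
include hθ

theorem BiDiffOp.map_eval (φ : R →+* A) (c : BiDiffOp m N R) (x y : Fin N → A) :
    θ ∘ c.eval φ x y = c.eval (θ.comp φ) (θ ∘ x) (θ ∘ y) := by
  funext k
  simp [BiDiffOp.eval, Finsupp.sum, map_dPow hθ]

theorem BiDiffOp.map_coad (φ : R →+* A) (c : BiDiffOp m N R) (x v : Fin N → A) :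
    θ ∘ c.coad φ x v = c.coad (θ.comp φ) (θ ∘ x) (θ ∘ v) := by
  funext k
  simp [BiDiffOp.coad_apply, Finsupp.sum, map_dPow hθ, map_negDPow hθ]

theorem map_matAct (φ : R →+* A) (B : Matrix (Fin N) (Fin N) (MIdx m →₀ R)) (y : Fin N → A) :
    θ ∘ matAct φ B y = matAct (θ.comp φ) B (θ ∘ y) := by
  funext k
  simp [matAct, Finsupp.sum, map_dPow hθ]

end Hom

theorem matAct_sub (φ : R →+* A) (B : Matrix (Fin N) (Fin N) (MIdx m →₀ R)) (y z : Fin N → A) :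
    matAct φ B (y - z) = matAct φ B y - matAct φ B z := by
  funext k
  simp [matAct, Finsupp.sum, mul_sub]

/-- The matrix differential operator obtained from `B` by applying the map `E` to its
coefficients, acting on `A^N`. -/
noncomputable def matActCoeff (E : A → A) (φ : R →+* A)
    (B : Matrix (Fin N) (Fin N) (MIdx m →₀ R)) (y : Fin N → A) : Fin N → A :=
  fun i => ∑ j, (B i j).sum fun s a => E (φ a) * dPow s (y j)

theorem map_matActCoeff {θ : A →+* A'}
    (hθ : ∀ (l : Fin m) (a : A), θ (DiffRing.d l a) = DiffRing.d l (θ a))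
    {E : A → A} {E' : A' → A'} {φ : R →+* A} {φ' : R →+* A'}
    (hE : ∀ a, θ (E (φ a)) = E' (φ' a))
    (B : Matrix (Fin N) (Fin N) (MIdx m →₀ R)) (y : Fin N → A) :
    θ ∘ matActCoeff E φ B y = matActCoeff E' φ' B (θ ∘ y) := by
  funext k
  simp [matActCoeff, Finsupp.sum, map_dPow hθ, hE]

theorem derivation_pairing (E : Derivation ℤ A A) (w y : Fin N → A) :
    E (pairing w y) = pairing (E ∘ w) y + pairing w (E ∘ y) := by
  simp only [pairing, map_sum, Derivation.leibniz, smul_eq_mul, Finset.sum_add_distrib,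
    Function.comp_apply]
  rw [add_comm]
  simp only [mul_comm]

end Operators

section Brackets

variable {m N : ℕ} {R S : Type u} [CommRing R] [CommRing S] [DiffRing m S]

theorem evolution_comp_matAct {K : Type*} [CommRing K] (Q : Fin N → Jet m N S)
    (φ : K →+* Jet m N S)
    (B : Matrix (Fin N) (Fin N) (MIdx m →₀ K)) (y : Fin N → Jet m N S) :
    evolution Q ∘ matAct φ B y
      = matActCoeff (evolution Q) φ B y + matAct φ B (evolution Q ∘ y) := by
  funext i
  simp only [matAct, matActCoeff, Finsupp.sum, Function.comp_apply, map_sum, Derivation.leibniz,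
    smul_eq_mul, Pi.add_apply, ← Finset.sum_add_distrib, evolution_dPow]
  simp only [mul_comm, add_comm]

theorem evolution_pairing (Q : Fin N → Jet m N S) (w y : Fin N → Jet m N S) :
    evolution Q (pairing w y)
      = pairing (evolution Q ∘ w) y + pairing w (evolution Q ∘ y) :=
  derivation_pairing ((evolution Q).restrictScalars ℤ) w y

/-- The structure map `R → S[uᵢ^(s)]`. -/
noncomputable abbrev jetMap {K : Type*} [CommRing K] (N : ℕ) (φ : R →+* K) : R →+* Jet m N K :=
  (C : K →+* Jet m N K).comp φ

theorem map_comp_uGen {K L : Type*} [CommRing K] [CommRing L] (ψ : K →+* L) :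
    MvPolynomial.map ψ ∘ (uGen : Fin N → Jet m N K) = uGen := by
  funext i
  simp [uGen]

theorem map_comp_jetMap {K L : Type*} [CommRing K] [CommRing L] (ψ : K →+* L) (φ : R →+* K) :
    (MvPolynomial.map ψ : Jet m N K →+* Jet m N L).comp (jetMap N φ) = jetMap N (ψ.comp φ) := by
  ext a
  simp

/-! ### The elements `H^~` -/

/-- The Fréchet derivative of `u ↦ x · u` is `v ↦ x · v`, and its adjoint is `-[x, ·]`. -/
theorem sum_frechetAdj_coad (φ : R →+* S) (c : BiDiffOp m N R) (x : Fin N → S)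
    (g : Fin N → Jet m N S) (l : Fin N) :
    ∑ j, frechetAdj l (c.coad (jetMap N φ) (fun i => C (x i)) uGen j) (g j)
      = -c.eval (jetMap N φ) (fun i => C (x i)) g l := by
  have h : ∀ (b : S) (k : Fin N) (f : Jet m N S),
      frechetAdj l (C b * uGen k) f = if k = l then C b * f else 0 := by
    intro b k f
    rw [frechetAdj_mul, frechetAdj_C, zero_add, uGen, frechetAdj_X]
    simp
  have hd : ∀ (s : MIdx m) (b : S), dPow s (C b : Jet m N S) = C (dPow s b) := fun s b =>
    (map_dPow (isDiffExt_C (N := N)).map_d s b).symm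
  simp only [BiDiffOp.coad_apply, BiDiffOp.eval, Finsupp.sum, map_neg, map_sum,
    AddMonoidHom.neg_apply, AddMonoidHom.finsetSum_apply, frechetAdj_negDPow, hd,
    RingHom.comp_apply, ← C_mul, h]
  rw [Finset.sum_neg_distrib]
  congr 1
  refine Finset.sum_comm.trans ?_
  rw [Finset.sum_eq_single l]
  · simp only [if_true]
    rw [Finset.sum_comm]
  · intro k _ hk
    simp [hk]
  · simp

theorem varDer_hat (φ : R →+* S) (c : BiDiffOp m N R) (x : Fin N → S) (H : Jet m N S) :
    varDer (hat φ c x H) = hat φ c x ∘ varDer H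
      - c.eval (jetMap N φ) (fun i => C (x i)) (varDer H) := by
  funext i
  rw [hat, varDer_evolution, sum_frechetAdj_coad]
  simp [sub_eq_add_neg]

/-- The relation that defines `H^~` holds for `-(δH/δu) · u`; skewsymmetry of the bracket exchanges
the roles of `x` and `δH/δu`. -/
theorem modTot_pairing_coad_varDer [DiffRing m R] (φ : R →+* S) (hφ : IsDiffExt m φ)
    {c : BiDiffOp m N R} (hc : IsDiffLie c) (x : Fin N → S) (H : Jet m N S) :
    modTot m _ (pairing (-c.coad (jetMap N φ) (varDer H) uGen) (fun i => C (x i)))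
      = modTot m _ (hat φ c x H) := by
  rw [pairing_neg_left, map_neg, BiDiffOp.modTot_pairing_coad,
    hc.skew _ (jetMap N φ) (isDiffExt_C.comp hφ), pairing_neg_right, map_neg, hat,
    modTot_evolution, BiDiffOp.modTot_pairing_coad, neg_neg]

theorem isTilde_coad [DiffRing m R] (φ : R →+* S) (hφ : IsDiffExt m φ) {c : BiDiffOp m N R}
    (hc : IsDiffLie c) (H : Jet m N S) :
    IsTilde φ c H (-c.coad (jetMap N φ) (varDer H) uGen) := by
  intro T _ _ ψ hψ x
  rw [totEq_iff, ← modTot_pairing_coad_varDer _ (hψ.comp hφ) hc]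
  have h1 : MvPolynomial.map ψ ∘ varDer H = varDer (MvPolynomial.map ψ H) :=
    funext fun i => map_varDer hψ.map_d H i
  have h2 := BiDiffOp.map_coad (map_map_d hψ.map_d) (jetMap N φ) c (varDer H) uGen
  rw [h1, map_comp_uGen, map_comp_jetMap] at h2
  rw [← h2]
  congr 2
  funext i
  simp

/-- The exchange of the two families of generators in `S[xᵢ^(s)][uᵢ^(s)]`. -/
noncomputable def jetSwap {K : Type*} [CommRing K] :
    Jet m N (Jet m N K) →+* Jet m N (Jet m N K) :=
  eval₂Hom (MvPolynomial.map C) fun p => C (X p)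

theorem jetSwap_d (l : Fin m) (P : Jet m N (Jet m N S)) :
    jetSwap (DiffRing.d l P) = DiffRing.d l (jetSwap P) := by
  refine map_d_of_generators (fun l a => ?_) (fun l p => ?_) l P
  · simp only [jetSwap, eval₂Hom_C]
    exact map_map_d isDiffExt_C.map_d l a
  · simp only [jetSwap, eval₂Hom_X']
    rw [d_C, d_X]

/-- An element of `S[uᵢ^(s)]^N` is determined by the class, modulo total derivatives, of its pairing
with the generic element `x` of `S[xᵢ^(s)]^N`. Exchanging the roles of `x` and `u` turns the pairing
into a linear Hamiltonian, and the variational derivative recovers its coefficients. -/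
theorem eq_of_pairing_totEq {w w' : Fin N → Jet m N S}
    (h : TotEq m (pairing (fun i => MvPolynomial.map (C : S →+* Jet m N S) (w i))
        (fun i => C (uGen i)))
      (pairing (fun i => MvPolynomial.map (C : S →+* Jet m N S) (w' i)) (fun i => C (uGen i)))) :
    w = w' := by
  have hmap : ∀ v : Fin N → Jet m N S,
      jetSwap (pairing (fun i => MvPolynomial.map (C : S →+* Jet m N S) (v i))
        (fun i => C (uGen i))) = linearHam v := by
    intro v
    have h1 : ∀ P : Jet m N S, jetSwap (MvPolynomial.map (C : S →+* Jet m N S) P) = C P := by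
      intro P
      have : (jetSwap : Jet m N (Jet m N S) →+* _).comp (MvPolynomial.map (C : S →+* Jet m N S))
          = C := by
        ext <;> simp [jetSwap]
      exact RingHom.congr_fun this P
    rw [pairing_comm, map_pairing, linearHam]
    congr 1
    · funext i
      simp [jetSwap, uGen]
    · funext i
      exact h1 (v i)
  have h2 := varDer_congr (h.map jetSwap_d)
  rw [hmap, hmap, varDer_linearHam, varDer_linearHam] at h2
  funext i
  exact C_injective _ _ (congrFun h2 i)

/-- The defining relation determines `H^~`. -/
theorem IsTilde.unique {φ : R →+* S} {c : BiDiffOp m N R} {H : Jet m N S}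
    {w w' : Fin N → Jet m N S} (h : IsTilde φ c H w) (h' : IsTilde φ c H w') : w = w' := by
  refine eq_of_pairing_totEq ?_
  have h1 := h (Jet m N S) C isDiffExt_C uGen
  have h2 := h' (Jet m N S) C isDiffExt_C uGen
  rw [totEq_iff] at h1 h2 ⊢
  rw [h1, h2]

/-! ### The criterion as a condition on variational derivatives -/

/-- The bidifferential expression in `h` and `f` that measures the failure of the relation
`X^({H, F}) - {X^(H), F} - {H, X^(F)} ∼ ⟨[H^~, F^~], x⟩` when `h` and `f` are the variational
derivatives of `H` and `F`. -/
noncomputable def actionDefect (φ : R →+* S) (c c' : BiDiffOp m N R)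
    (B : Matrix (Fin N) (Fin N) (MIdx m →₀ Jet m N R)) (x : Fin N → S)
    (h f : Fin N → Jet m N S) : Jet m N S :=
  pairing f (matActCoeff (hat φ c x) (MvPolynomial.map φ) B h)
    + pairing (c.eval (jetMap N φ) (fun i => C (x i)) f) (matAct (MvPolynomial.map φ) B h)
    + pairing f (matAct (MvPolynomial.map φ) B (c.eval (jetMap N φ) (fun i => C (x i)) h))
    - pairing (c'.eval (jetMap N φ) (-c.coad (jetMap N φ) h uGen) (-c.coad (jetMap N φ) f uGen))
        (fun i => C (x i))

theorem actionRel_iff [DiffRing m R] (φ : R →+* S) (hφ : IsDiffExt m φ) {c : BiDiffOp m N R}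
    (hc : IsDiffLie c) (c' : BiDiffOp m N R)
    (B : Matrix (Fin N) (Fin N) (MIdx m →₀ Jet m N R)) (x : Fin N → S) (H F : Jet m N S) :
    ActionRel φ c c' B x H F ↔ TotEq m (actionDefect φ c c' B x (varDer H) (varDer F)) 0 := by
  -- The terms with `X^` applied to the variational derivatives cancel by the Leibniz rule.
  have key : ∀ wH wF, wH = -c.coad (jetMap N φ) (varDer H) uGen →
      wF = -c.coad (jetMap N φ) (varDer F) uGen →
      hat φ c x (poisson φ B H F) - poisson φ B (hat φ c x H) F - poisson φ B H (hat φ c x F)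
        - pairing (c'.eval (jetMap N φ) wH wF) (fun i => C (x i))
      = actionDefect φ c c' B x (varDer H) (varDer F) - 0 := by
    rintro _ _ rfl rfl
    rw [actionDefect, poisson, poisson, poisson, varDer_hat, varDer_hat, matAct_sub,
      pairing_sub_left, pairing_sub_right, hat, evolution_pairing, evolution_comp_matAct,
      pairing_add_right]
    ring
  constructor
  · rintro ⟨wH, wF, hH, hF, w, hw⟩
    rw [key wH wF (hH.unique (isTilde_coad φ hφ hc H)) (hF.unique (isTilde_coad φ hφ hc F))] at hw
    exact ⟨w, hw⟩
  · rintro ⟨w, hw⟩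
    exact ⟨_, _, isTilde_coad φ hφ hc H, isTilde_coad φ hφ hc F, w, (key _ _ rfl rfl).trans hw⟩

/-- The differential homomorphism from the differential polynomials with coefficients in
`S[uᵢ^(s)]` to `S[uᵢ^(s)]` that identifies the new generators with the old ones and is the identity on
coefficients. -/
noncomputable def jetFold {K : Type*} [CommRing K] : Jet m N (Jet m N K) →+* Jet m N K :=
  eval₂Hom (RingHom.id _) X

@[simp]
theorem jetFold_C {K : Type*} [CommRing K] (P : Jet m N K) : jetFold (C P) = P :=
  eval₂Hom_C _ _ _

@[simp]
theorem jetFold_X {K : Type*} [CommRing K] (p : Fin N × MIdx m) :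
    (jetFold (X p) : Jet m N K) = X p :=
  eval₂Hom_X' _ _ _

theorem jetFold_d (l : Fin m) (P : Jet m N (Jet m N S)) :
    jetFold (DiffRing.d l P) = DiffRing.d l (jetFold P) :=
  map_d_of_generators (fun l a => by rw [jetFold_C, jetFold_C])
    (fun l p => by rw [jetFold_X, jetFold_X, d_X]) l P

theorem jetFold_comp_map_C {K : Type*} [CommRing K] :
    jetFold.comp (MvPolynomial.map (C : K →+* Jet m N K)) = RingHom.id (Jet m N K) := by
  ext <;> simp

theorem jetFold_hat (φ : R →+* S) (c : BiDiffOp m N R) (x : Fin N → S) (P : Jet m N S) :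
    jetFold (hat ((C : S →+* Jet m N S).comp φ) c (fun i => C (x i))
      (MvPolynomial.map (C : S →+* Jet m N S) P)) = hat φ c x P := by
  have h := BiDiffOp.map_coad jetFold_d (jetMap N ((C : S →+* Jet m N S).comp φ)) c
    (fun i => C (C (x i))) uGen
  have h1 : (jetFold : Jet m N (Jet m N S) →+* _).comp (jetMap N ((C : S →+* Jet m N S).comp φ))
      = jetMap N φ := by
    ext a; simp
  have h2 : jetFold ∘ (fun i => C (C (x i))) = (fun i => C (x i) : Fin N → Jet m N S) := by
    funext i; simp
  have h3 : jetFold ∘ uGen = (uGen : Fin N → Jet m N S) := by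
    funext i; simp [uGen]
  rw [h1, h2, h3] at h
  have hid : ∀ P : Jet m N S, jetFold (MvPolynomial.map C P) = P := fun P =>
    RingHom.congr_fun jetFold_comp_map_C P
  induction P using MvPolynomial.induction_on with
  | C a => simp [hat]
  | add P Q hP hQ => simp only [map_add, hP, hQ]
  | mul_X P p hP =>
    rw [RingHom.map_mul, Derivation.leibniz, Derivation.leibniz, map_add, smul_eq_mul,
      smul_eq_mul, smul_eq_mul, smul_eq_mul, RingHom.map_mul, RingHom.map_mul, hP, hid, hid,
      MvPolynomial.map_X, hat, hat, evolution_X, evolution_X, map_dPow jetFold_d, ← h]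
    rfl

/-- The defect at arbitrary `h` and `f` is the image of a defect at constant ones, over the
extension `S[uᵢ^(s)]` of `S`. -/
theorem jetFold_actionDefect (φ : R →+* S) (c c' : BiDiffOp m N R)
    (B : Matrix (Fin N) (Fin N) (MIdx m →₀ Jet m N R)) (x : Fin N → S)
    (h f : Fin N → Jet m N S) :
    jetFold (actionDefect ((C : S →+* Jet m N S).comp φ) c c' B (fun i => C (x i))
      (fun i => C (h i)) (fun i => C (f i))) = actionDefect φ c c' B x h f := by
  have h1 : (jetFold : Jet m N (Jet m N S) →+* _).comp (jetMap N ((C : S →+* Jet m N S).comp φ))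
      = jetMap N φ := by
    ext a; simp
  have h2 : ∀ y : Fin N → Jet m N S, jetFold ∘ (fun i => C (y i)) = y := by
    intro y; funext i; simp
  have h3 : jetFold ∘ uGen = (uGen : Fin N → Jet m N S) := by
    funext i; simp [uGen]
  have h4 : jetFold.comp (MvPolynomial.map ((C : S →+* Jet m N S).comp φ))
      = (MvPolynomial.map φ : Jet m N R →+* _) := by
    ext <;> simp
  have h5 : ∀ b : Jet m N R, jetFold (hat ((C : S →+* Jet m N S).comp φ) c (fun i => C (x i))
      (MvPolynomial.map ((C : S →+* Jet m N S).comp φ) b)) = hat φ c x (MvPolynomial.map φ b) := by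
    intro b
    rw [← jetFold_hat φ c x (MvPolynomial.map φ b), MvPolynomial.map_map]
  have h6 : ∀ v : Fin N → Jet m N (Jet m N S), jetFold ∘ (-v) = -(jetFold ∘ v) := by
    intro v; funext i; simp
  simp only [actionDefect, map_add, map_sub, map_pairing, map_matActCoeff jetFold_d h5,
    map_matAct jetFold_d, BiDiffOp.map_eval jetFold_d, BiDiffOp.map_coad jetFold_d, h1, h2, h3, h4,
    h6]

end Brackets

end DiffHam

theorem theorem5p39 (m N : ℕ) (R : Type u) [CommRing R] [DiffHam.DiffRing m R]
    (c c' : DiffHam.BiDiffOp m N R) (hc : DiffHam.IsDiffLiePair c c')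
    (B : Matrix (Fin N) (Fin N) (DiffHam.MIdx m →₀ DiffHam.Jet m N R))
    (hB : DiffHam.IsHamiltonian B) (x : Fin N → R) :
    (∀ (S : Type u) [CommRing S] [DiffHam.DiffRing m S] (φ : R →+* S), DiffHam.IsDiffExt m φ →
      ∀ H F : DiffHam.Jet m N S, DiffHam.ActionRel φ c c' B (fun i => φ (x i)) H F) ↔
    (∀ (S : Type u) [CommRing S] [DiffHam.DiffRing m S] (φ : R →+* S), DiffHam.IsDiffExt m φ →
      ∀ y z : Fin N → S, DiffHam.ActionRel φ c c' B (fun i => φ (x i))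
        (DiffHam.linearHam y) (DiffHam.linearHam z)) := by
  refine ⟨fun h S _ _ φ hφ y z => h S φ hφ _ _, fun h S _ _ φ hφ H F => ?_⟩
  have hext := DiffHam.IsDiffExt.comp (DiffHam.isDiffExt_C (m := m) (N := N)) hφ
  have h1 := h (DiffHam.Jet m N S) _ hext (DiffHam.varDer H) (DiffHam.varDer F)
  rw [DiffHam.actionRel_iff _ hext hc.left, DiffHam.varDer_linearHam,
    DiffHam.varDer_linearHam] at h1
  rw [DiffHam.actionRel_iff _ hφ hc.left]
  have h2 := h1.map DiffHam.jetFold_d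
  rw [map_zero] at h2
  exact DiffHam.jetFold_actionDefect φ c c' B (fun i => φ (x i)) _ _ ▸ h2
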